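/- Let $p,q$ be two distinct prime numbers, $k$ a field of characteristic $p$, and $\Gamma$ a subgroup of $\mathbb{Q}$ containing $\frac1{q^i}$ for all $i\in\mathbb{N}$. Let $k((t^\Gamma))$ be the field of generalized power series with coefficients in $k$ and exponents in $\Gamma$, with its $t$-adic valuation $v$, and let $w=\sum_{i=1}^\infty t^{1-1/q^i}\in k((t^\Gamma))$. Let $k(t^\Gamma)$ be the subfield of $k((t^\Gamma))$ generated over $k$ by all the monomials $t^\gamma$, $\gamma\in\Gamma$, and let $K=k\langle t^\Gamma,w\rangle\subset k((t^\Gamma))$ be the henselization of $k(t^\Gamma,w)$, that is, the smallest subfield of $k((t^\Gamma))$ containing $k(t^\Gamma,w)$ whose valuation ring satisfies Hensel's lemma (simple roots of monic polynomials modulo the maximal ideal lift to roots in the ring). Then every element $y\in K$ is $w$-quasi-finite: there exist $\gamma\in\Gamma$ with $\gamma\le 0$, an integer $n\ge 0$, elements $h_1,\dots,h_n\in k(t^\Gamma)[w]$ with $v(h_i)>0$ for all $i$, and a formal power series $g=\sum_\alpha c_\alpha X^\alpha$ in $n$ variables over $k$ such that $y=t^\gamma g(h_1,\dots,h_n)$,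 where $g(h_1,\dots,h_n)$ is the sum in $k((t^\Gamma))$ of the summable family $(c_\alpha h_1^{\alpha_1}\cdots h_n^{\alpha_n})_\alpha$. -/

import Mathlib

/-- The monomial `t ^ γ` of the generalized power series field `k((t^Γ))`, for an ordered
abelian group `Γ`. -/
noncomputable def tPow (k Γ : Type*) [Field k] [AddCommGroup Γ] [LinearOrder Γ]
    [IsOrderedAddMonoid Γ] (γ : Γ) : HahnSeries Γ k :=
  HahnSeries.single γ 1

/-- The generalized power series `w = ∑_{i ≥ 1} t ^ (1 - 1 / q ^ i)` of `k((t^Γ))`, for a subgroup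
`Γ` of the rational numbers that contains all the exponents. -/
noncomputable def wSeries (k : Type*) [Field k] (Γ : AddSubgroup ℚ) (q : ℕ) : HahnSeries Γ k where
  coeff γ := open Classical in if ∃ i : ℕ, 1 ≤ i ∧ (γ : ℚ) = 1 - 1 / (q : ℚ) ^ i then 1 else 0
  isPWO_support' := by
    classical
    intro f
    have hf' : ∀ n, ∃ i : ℕ, 1 ≤ i ∧ (((f n).1 : Γ) : ℚ) = 1 - 1 / (q : ℚ) ^ i := by
      intro n
      by_contra hn
      exact (f n).2 (by simp only [if_neg hn])
    choose i hi1 hi using hf'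
    obtain ⟨m, n, hmn, hle⟩ := wellQuasiOrdered_le i
    refine ⟨m, n, hmn, ?_⟩
    change (((f m).1 : Γ) : ℚ) ≤ (((f n).1 : Γ) : ℚ)
    rw [hi m, hi n]
    have hanti : (1 / (q : ℚ)) ^ (i n) ≤ (1 / (q : ℚ)) ^ (i m) := by
      refine pow_le_pow_of_le_one (by positivity) ?_ hle
      rcases Nat.eq_zero_or_pos q with h | h
      · simp [h]
      · rw [div_le_one (by exact_mod_cast h)]
        exact_mod_cast h
    rw [one_div_pow, one_div_pow] at hanti
    linarith

/-- The subfield `k(t^Γ)` of `k((t^Γ))` generated over `k` by all the monomials `t ^ γ`. -/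
noncomputable def monomialField (k Γ : Type*) [Field k] [AddCommGroup Γ] [LinearOrder Γ]
    [IsOrderedAddMonoid Γ] :
    IntermediateField k (HahnSeries Γ k) :=
  IntermediateField.adjoin k (Set.range (tPow k Γ))

/-- The subfield `k(t^Γ, w)` of `k((t^Γ))` generated over `k` by all the monomials `t ^ γ`
and an element `w`. -/
noncomputable def monomialFieldAdjoin {k Γ : Type*} [Field k] [AddCommGroup Γ] [LinearOrder Γ]
    [IsOrderedAddMonoid Γ]
    (w : HahnSeries Γ k) : IntermediateField k (HahnSeries Γ k) :=
  IntermediateField.adjoin k (Set.range (tPow k Γ) ∪ {w})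

/-- The restriction of the `t`-adic valuation to a subfield of `k((t^Γ))`. -/
noncomputable def restrictedVal {k Γ : Type*} [Field k] [AddCommGroup Γ] [LinearOrder Γ]
    [IsOrderedAddMonoid Γ]
    (E : IntermediateField k (HahnSeries Γ k)) : AddValuation E (WithTop Γ) :=
  (HahnSeries.addVal Γ k).comap (algebraMap E (HahnSeries Γ k))

/-- A subfield `E` of `k((t^Γ))`, with the restriction of the `t`-adic valuation, is henselian:
its valuation ring satisfies Hensel's lemma. -/
def IsHenselianSubfield {k Γ : Type*} [Field k] [AddCommGroup Γ] [LinearOrder Γ]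
    [IsOrderedAddMonoid Γ]
    (E : IntermediateField k (HahnSeries Γ k)) : Prop :=
  HenselianLocalRing (restrictedVal E).toValuation.integer

/-- The henselization, inside the henselian field `k((t^Γ))`, of a valued subfield `F`: the
smallest henselian subfield of `k((t^Γ))` that contains `F`. -/
noncomputable def henselizationIn {k Γ : Type*} [Field k] [AddCommGroup Γ] [LinearOrder Γ]
    [IsOrderedAddMonoid Γ]
    (F : IntermediateField k (HahnSeries Γ k)) : IntermediateField k (HahnSeries Γ k) :=
  sInf {E | F ≤ E ∧ IsHenselianSubfield E}

/-- `z = g(h₁, …, hₙ)` in `k((t^Γ))`: the family of the terms `c_α h₁ ^ α₁ ⋯ hₙ ^ αₙ` of the formal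
power series `g = ∑ c_α X ^ α` is summable in `k((t^Γ))` and `z` is its sum. -/
def IsPowerSeriesValue {k Γ : Type*} [Field k] [AddCommGroup Γ] [LinearOrder Γ]
    [IsOrderedAddMonoid Γ] {n : ℕ}
    (g : MvPowerSeries (Fin n) k) (h : Fin n → HahnSeries Γ k) (z : HahnSeries Γ k) : Prop :=
  ∃ s : HahnSeries.SummableFamily Γ k (Fin n →₀ ℕ),
    (∀ α : Fin n →₀ ℕ, s α = MvPowerSeries.coeff α g • ∏ i, h i ^ α i) ∧ z = s.hsum

/-- An element `y` of `k((t^Γ))` is `w`-quasi-finite if `y = t ^ γ g(h₁, …, hₙ)` for some `γ ≤ 0` in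
`Γ`, some formal power series `g` in `n` variables over `k` and some elements `h₁, …, hₙ` of
`k(t^Γ)[w]` of strictly positive value. -/
def IsQuasiFinite {k Γ : Type*} [Field k] [AddCommGroup Γ] [LinearOrder Γ]
    [IsOrderedAddMonoid Γ] (w y : HahnSeries Γ k) : Prop :=
  ∃ (γ : Γ) (n : ℕ) (h : Fin n → HahnSeries Γ k) (g : MvPowerSeries (Fin n) k)
    (z : HahnSeries Γ k),
    γ ≤ 0 ∧
    (∀ i, h i ∈ Algebra.adjoin (monomialField k Γ) ({w} : Set (HahnSeries Γ k))) ∧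
    (∀ i, 0 < HahnSeries.addVal Γ k (h i)) ∧
    IsPowerSeriesValue g h z ∧ y = tPow k Γ γ * z

/-! Let `S` be the ring k(t^Γ)[w] and let P be the ring of values g(h₁, …, hₙ) of power series over
k at elements of `S` of positive value. Let E be the set of all y such that t^γ y lies in P for some
γ. The claim follows once E is known to be a henselian field containing k(t^Γ, w), since the
henselization is the smallest such field.

The crux is that P is the whole valuation ring of E (`mem_powerSeriesClosure_iff`). By
`exists_add_eq_single_mul`, t^γ z with z in P splits as r + a with r in `S` and a in P: write g = c
+ ∑ uᵢ Xᵢ and move a factor t^ε, with ε ≤ v(hᵢ), from hᵢ to t^γ. In an archimedean group the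
exponent becomes nonnegative after finitely many rounds. If t^γ z has nonnegative value, so has r,
and then r is a constant plus an element of `S` of positive value, hence in P.

Inverses in E come from inverses of power series with nonzero constant term. Henselianity comes from
k[[X₁, …, Xₙ]]: a polynomial over P has finitely many coefficients, so it lifts to power series in
finitely many variables, where Hensel's lemma gives a root to evaluate. -/

namespace HahnSeries

/-! ### Evaluation of power series at Hahn series of positive order -/

open SummableFamily

/-- The monomials `∏ i, h i ^ α i` in elements `h i` of positive order, as a summable family. -/
theorem exists_summableFamily_prod_pow {k Γ : Type*} [Field k] [AddCommGroup Γ] [LinearOrder Γ]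
    [IsOrderedAddMonoid Γ] {n : ℕ} (h : Fin n → HahnSeries Γ k)
    (hh : ∀ i, 0 < (h i).orderTop) :
    ∃ s : SummableFamily Γ k (Fin n →₀ ℕ), ∀ α, s α = ∏ i, h i ^ α i := by
  induction n with
  | zero => exact ⟨SummableFamily.const _ 1, fun α => by simp [SummableFamily.const]⟩
  | succ n ih =>
    obtain ⟨s, hs⟩ := ih (Fin.tail h) fun i => hh i.succ
    let e : ℕ × (Fin n →₀ ℕ) ≃ (Fin (n + 1) →₀ ℕ) :=
      { toFun := fun a => Finsupp.cons a.1 a.2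
        invFun := fun b => (b 0, Finsupp.tail b)
        left_inv := fun a => by simp
        right_inv := fun b => by simp [Finsupp.cons_tail] }
    refine ⟨SummableFamily.Equiv e ((powers (h 0)).mul s), fun α => ?_⟩
    simp [e, hs, powers_of_orderTop_pos (hh 0), Fin.prod_univ_succ, Fin.tail, Finsupp.tail_apply]

/-- At each exponent only finitely many pairs (α, β) contribute to the product of the two sums;
grouping them by α + β gives the Cauchy product. -/
theorem SummableFamily.hsum_smulFamily_mul {k Γ σ : Type*} [Field k] [AddCommGroup Γ]
    [LinearOrder Γ] [IsOrderedAddMonoid Γ] (s : SummableFamily Γ k (σ →₀ ℕ))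
    (hs : ∀ α β, s (α + β) = s α * s β) (f g : MvPowerSeries σ k) :
    (smulFamily (fun α => MvPowerSeries.coeff α (f * g)) s).hsum =
      (smulFamily (fun α => MvPowerSeries.coeff α f) s).hsum *
        (smulFamily (fun α => MvPowerSeries.coeff α g) s).hsum := by
  classical
  rw [← hsum_mul]
  ext γ
  set u := (smulFamily (fun α => MvPowerSeries.coeff α f) s).mul
    (smulFamily (fun α => MvPowerSeries.coeff α g) s) with hu
  set T := (u.coeff γ).support with hT
  have huv : ∀ a, (u a).coeff γ =
      (MvPowerSeries.coeff a.1 f * MvPowerSeries.coeff a.2 g) * (s (a.1 + a.2)).coeff γ := by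
    intro a
    simp [hu, hs, mul_assoc, mul_left_comm]
  have hmem : ∀ a, a ∉ T → (u a).coeff γ = 0 := by
    intro a ha
    rwa [hT, Finsupp.notMem_support_iff] at ha
  have hsum : ∀ δ, ((smulFamily (fun α => MvPowerSeries.coeff α (f * g)) s) δ).coeff γ =
      ∑ a ∈ T with a.1 + a.2 = δ, (u a).coeff γ := by
    intro δ
    have h1 : ((smulFamily (fun α => MvPowerSeries.coeff α (f * g)) s) δ).coeff γ =
        ∑ a ∈ Finset.HasAntidiagonal.antidiagonal δ, (u a).coeff γ := by
      simp only [smulFamily_toFun, HahnSeries.coeff_smul, smul_eq_mul, MvPowerSeries.coeff_mul,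
        Finset.sum_mul]
      refine Finset.sum_congr rfl fun a ha => ?_
      rw [huv, Finset.HasAntidiagonal.mem_antidiagonal.1 ha]
    rw [h1]
    refine (Finset.sum_subset (fun a ha => ?_) fun a ha ha' => ?_).symm
    · simpa using (Finset.mem_filter.1 ha).2
    · refine hmem a fun haT => ha' ?_
      simpa [haT] using ha
  rw [coeff_hsum, coeff_hsum,
    finsum_eq_sum_of_support_subset (s := T) _ (fun a ha => by
      by_contra h
      exact ha (hmem a (by simpa using h))),
    finsum_eq_sum_of_support_subset (s := T.image fun a => a.1 + a.2) _ (fun δ hδ => by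
      by_contra h
      refine hδ ((hsum δ).trans ?_)
      refine Finset.sum_eq_zero fun a ha => (h ?_).elim
      rw [Finset.mem_filter] at ha
      exact Finset.mem_coe.2 (Finset.mem_image.2 ⟨a, ha⟩))]
  simp_rw [hsum]
  exact Finset.sum_fiberwise_of_maps_to (fun a ha => Finset.mem_image_of_mem _ ha) _

/-- The summable family of the monomials `∏ i, h i ^ α i`. -/
noncomputable def monomials {k Γ : Type*} [Field k] [AddCommGroup Γ] [LinearOrder Γ]
    [IsOrderedAddMonoid Γ] {n : ℕ} (h : Fin n → HahnSeries Γ k)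
    (hh : ∀ i, 0 < (h i).orderTop) : SummableFamily Γ k (Fin n →₀ ℕ) :=
  (exists_summableFamily_prod_pow h hh).choose

theorem monomials_apply {k Γ : Type*} [Field k] [AddCommGroup Γ] [LinearOrder Γ]
    [IsOrderedAddMonoid Γ] {n : ℕ} (h : Fin n → HahnSeries Γ k)
    (hh : ∀ i, 0 < (h i).orderTop) (α : Fin n →₀ ℕ) : monomials h hh α = ∏ i, h i ^ α i :=
  (exists_summableFamily_prod_pow h hh).choose_spec α

/-- Evaluation of multivariate power series at Hahn series of positive order. -/
noncomputable def mvEval {k Γ : Type*} [Field k] [AddCommGroup Γ] [LinearOrder Γ]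
    [IsOrderedAddMonoid Γ] {n : ℕ} (h : Fin n → HahnSeries Γ k)
    (hh : ∀ i, 0 < (h i).orderTop) : MvPowerSeries (Fin n) k →ₐ[k] HahnSeries Γ k :=
  AlgHom.ofLinearMap
    { toFun := fun g => (smulFamily (fun α => MvPowerSeries.coeff α g) (monomials h hh)).hsum
      map_add' := fun f g => by
        rw [← hsum_add]
        congr 1
        ext1 α
        simp [add_smul]
      map_smul' := fun c g => by
        ext γ
        simpa only [coeff_hsum, smulFamily_toFun, HahnSeries.coeff_smul, map_smul, smul_assoc, RingHom.id_apply]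
          using (smul_finsum c _).symm }
    (by
      classical
      ext γ
      simp only [LinearMap.coe_mk, AddHom.coe_mk, coeff_hsum, smulFamily_toFun,
        MvPowerSeries.coeff_one]
      rw [finsum_eq_single _ 0 fun α hα => by simp [hα]]
      simp [monomials_apply])
    (fun f g => hsum_smulFamily_mul _ (fun α β => by
      simp only [monomials_apply, ← Finset.prod_mul_distrib]
      exact Finset.prod_congr rfl fun i _ => _root_.pow_add (h i) _ _) f g)

section

variable {k Γ : Type*} [Field k] [AddCommGroup Γ] [LinearOrder Γ] [IsOrderedAddMonoid Γ] {n : ℕ}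

theorem mvEval_apply (h : Fin n → HahnSeries Γ k) (hh : ∀ i, 0 < (h i).orderTop)
    (g : MvPowerSeries (Fin n) k) :
    mvEval h hh g = (smulFamily (fun α => MvPowerSeries.coeff α g) (monomials h hh)).hsum :=
  rfl

theorem mvEval_C (h : Fin n → HahnSeries Γ k) (hh : ∀ i, 0 < (h i).orderTop) (c : k) :
    mvEval h hh (MvPowerSeries.C c) = C c := by
  have := (mvEval h hh).commutes c
  simpa [HahnSeries.algebraMap_apply, MvPowerSeries.algebraMap_apply] using this

theorem mvEval_X (h : Fin n → HahnSeries Γ k) (hh : ∀ i, 0 < (h i).orderTop) (i : Fin n) :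
    mvEval h hh (MvPowerSeries.X i) = h i := by
  classical
  ext γ
  simp only [mvEval_apply, coeff_hsum, smulFamily_toFun, MvPowerSeries.coeff_X]
  rw [finsum_eq_single _ (Finsupp.single i 1) fun α hα => by simp [hα]]
  simp [monomials_apply, Finsupp.single_apply, pow_ite]

theorem isPowerSeriesValue_mvEval (h : Fin n → HahnSeries Γ k) (hh : ∀ i, 0 < (h i).orderTop)
    (g : MvPowerSeries (Fin n) k) : IsPowerSeriesValue g h (mvEval h hh g) :=
  ⟨smulFamily (fun α => MvPowerSeries.coeff α g) (monomials h hh),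
    fun α => by simp [monomials_apply], rfl⟩

/-- Adding unused variables does not change the value. This is what allows evaluations at different
tuples to be compared in a longer common tuple. -/
theorem mvEval_rename {m : ℕ} (e : Fin n ↪ Fin m) (h : Fin m → HahnSeries Γ k)
    (hh : ∀ i, 0 < (h i).orderTop) (g : MvPowerSeries (Fin n) k) :
    mvEval h hh (MvPowerSeries.rename e g) = mvEval (h ∘ e) (fun i => hh (e i)) g := by
  classical
  rw [mvEval_apply, mvEval_apply,
    ← hsum_embDomain _ ⟨Finsupp.embDomain e, Finsupp.embDomain_injective e⟩]
  congr 1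
  ext1 β
  by_cases hβ : ∃ α, Finsupp.embDomain e α = β
  · obtain ⟨α, rfl⟩ := hβ
    have := embDomain_image (smulFamily (fun α => MvPowerSeries.coeff α g)
      (monomials (h ∘ e) fun i => hh (e i))) ⟨Finsupp.embDomain e, Finsupp.embDomain_injective e⟩
      (a := α)
    refine Eq.trans ?_ this.symm
    simp only [smulFamily_toFun, MvPowerSeries.coeff_embDomain_rename, monomials_apply]
    congr 1
    rw [← Finset.prod_subset (Finset.subset_univ (Finset.univ.map e)) fun i _ hi => ?_]
    · simp
    · rw [Finsupp.embDomain_of_notMem_range, pow_zero]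
      simpa using hi
  · rw [SummableFamily.embDomain_of_notMem_range (h := by simpa using hβ)]
    simp only [smulFamily_toFun]
    rw [MvPowerSeries.coeff_rename_eq_zero, zero_smul]
    rintro ⟨α, hα⟩
    exact hβ ⟨α, (Finsupp.embDomain_eq_mapDomain e α).trans hα⟩

end

end HahnSeries

/-- A multivariate power series without constant term is a combination of the variables. -/
theorem MvPowerSeries.mem_span_range_X_iff {k σ : Type*} [Fintype σ] [Field k]
    {g : MvPowerSeries σ k} :
    g ∈ Ideal.span (Set.range (MvPowerSeries.X : σ → MvPowerSeries σ k)) ↔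
      MvPowerSeries.constantCoeff g = 0 := by
  classical
  constructor
  · intro hg
    have hle : Ideal.span (Set.range (MvPowerSeries.X : σ → MvPowerSeries σ k)) ≤
        RingHom.ker (MvPowerSeries.constantCoeff (σ := σ) (R := k)) := by
      rw [Ideal.span_le]
      rintro _ ⟨i, rfl⟩
      simp
    exact hle hg
  · intro hg
    have hex : ∀ β : {β : σ →₀ ℕ // β ≠ 0}, ∃ i, β.1 i ≠ 0 := fun β => by
      by_contra! h
      exact β.2 (Finsupp.ext h)
    -- `m β` picks one variable dividing X^β; each monomial of g is then assigned to the cofactor of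
    -- that single variable, so nothing is counted twice.
    choose m hm using hex
    rw [Ideal.mem_span_range_iff_exists_fun]
    obtain ⟨G, hG⟩ : ∃ G : σ → MvPowerSeries σ k, ∀ i α, MvPowerSeries.coeff α (G i) =
        if m ⟨α + Finsupp.single i 1, by simp⟩ = i then
          MvPowerSeries.coeff (α + Finsupp.single i 1) g else 0 :=
      ⟨fun i α => if m ⟨α + Finsupp.single i 1, by simp⟩ = i then
        MvPowerSeries.coeff (α + Finsupp.single i 1) g else 0, fun _ _ => rfl⟩
    refine ⟨G, ?_⟩
    ext β
    rw [map_sum]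
    have hterm : ∀ i, MvPowerSeries.coeff β (G i * X i) =
        if β i ≠ 0 then MvPowerSeries.coeff (β - Finsupp.single i 1) (G i) else 0 := by
      intro i
      rw [MvPowerSeries.X, MvPowerSeries.coeff_mul_monomial, mul_one]
      simp [Nat.one_le_iff_ne_zero]
    by_cases hβ : β = 0
    · subst hβ
      rw [MvPowerSeries.coeff_zero_eq_constantCoeff_apply, hg]
      refine Finset.sum_eq_zero fun i _ => ?_
      simp
    · have hle : ∀ i, β i ≠ 0 → Finsupp.single i 1 ≤ β := fun i hi => by
        simpa [Nat.one_le_iff_ne_zero] using hi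
      rw [Finset.sum_eq_single (m ⟨β, hβ⟩)]
      · rw [hterm, if_pos (hm ⟨β, hβ⟩), hG]
        simp [tsub_add_cancel_of_le (hle _ (hm ⟨β, hβ⟩))]
      · intro i _ hi
        rw [hterm]
        split_ifs with h
        · rw [hG]
          simp [tsub_add_cancel_of_le (hle i h), hi.symm]
        · rfl
      · simp

/-! ### Values and residues of evaluated power series -/

namespace HahnSeries

open SummableFamily

section

variable {k Γ : Type*} [Field k] [AddCommGroup Γ] [LinearOrder Γ] [IsOrderedAddMonoid Γ] {n : ℕ}

theorem addVal_single_one (γ : Γ) : addVal Γ k (single γ 1) = γ := by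
  rw [addVal_apply, orderTop_single one_ne_zero]

theorem single_one_mul_single_one_mul (γ δ : Γ) (x : HahnSeries Γ k) :
    single γ 1 * (single δ 1 * x) = single (γ + δ) 1 * x := by
  rw [← mul_assoc, single_mul_single, one_mul]

theorem single_neg_one_mul_cancel (γ : Γ) (x : HahnSeries Γ k) :
    single (-γ) 1 * (single γ 1 * x) = x := by
  rw [single_one_mul_single_one_mul, neg_add_cancel, single_zero_one, one_mul]

theorem addVal_C_nonneg (c : k) : 0 ≤ addVal Γ k (C c) := by
  rw [addVal_apply]
  exact orderTop_single_le

theorem addVal_pos_iff_of_nonneg {z : HahnSeries Γ k} (hz : 0 ≤ addVal Γ k z) :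
    0 < addVal Γ k z ↔ z.coeff 0 = 0 := by
  rw [addVal_apply] at hz ⊢
  constructor
  · intro h
    exact coeff_eq_zero_of_lt_orderTop h
  · intro h
    refine lt_of_le_of_ne hz fun h0 => ?_
    exact coeff_orderTop_ne (x := z) (g := 0) h0.symm h

theorem addVal_sub_C_pos {z : HahnSeries Γ k} (hz : 0 ≤ addVal Γ k z) :
    0 < addVal Γ k (z - C (z.coeff 0)) := by
  rw [addVal_pos_iff_of_nonneg ((addVal Γ k).map_le_sub hz (addVal_C_nonneg _))]
  simp

variable (h : Fin n → HahnSeries Γ k) (hh : ∀ i, 0 < (h i).orderTop)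

include hh in
theorem addVal_prod_pow_nonneg (s : Finset (Fin n)) (α : Fin n →₀ ℕ) :
    0 ≤ addVal Γ k (∏ i ∈ s, h i ^ α i) := by
  refine Finset.prod_induction _ (fun x => 0 ≤ addVal Γ k x) (fun a b ha hb => ?_) ?_ ?_
  · rw [AddValuation.map_mul]
    exact add_nonneg ha hb
  · simp
  · intro i _
    rw [AddValuation.map_pow]
    exact nsmul_nonneg (addVal_apply (x := h i) ▸ (hh i).le) _

include hh in
theorem addVal_prod_pow_pos {α : Fin n →₀ ℕ} (hα : α ≠ 0) :
    0 < addVal Γ k (∏ i, h i ^ α i) := by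
  obtain ⟨i, hi⟩ : ∃ i, α i ≠ 0 := by
    by_contra! h0
    exact hα (Finsupp.ext h0)
  rw [← Finset.mul_prod_erase Finset.univ _ (Finset.mem_univ i), AddValuation.map_mul,
    AddValuation.map_pow]
  exact add_pos_of_pos_of_nonneg ((nsmul_pos_iff hi).2 (addVal_apply (x := h i) ▸ hh i))
    (addVal_prod_pow_nonneg h hh _ α)

theorem addVal_mvEval_nonneg (g : MvPowerSeries (Fin n) k) : 0 ≤ addVal Γ k (mvEval h hh g) := by
  rw [addVal_apply, le_orderTop_iff_forall]
  intro γ hγ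
  rw [mvEval_apply, coeff_hsum]
  refine finsum_eq_zero_of_forall_eq_zero fun α => ?_
  have : (∏ i, h i ^ α i).coeff γ = 0 :=
    coeff_eq_zero_of_lt_orderTop
      (hγ.trans_le (addVal_apply (Γ := Γ) (R := k) ▸ addVal_prod_pow_nonneg h hh _ α))
  simp [monomials_apply, this]

theorem coeff_zero_mvEval (g : MvPowerSeries (Fin n) k) :
    (mvEval h hh g).coeff 0 = MvPowerSeries.constantCoeff g := by
  rw [mvEval_apply, coeff_hsum, finsum_eq_single _ 0 fun α hα => ?_]
  · simp [monomials_apply]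
  · have : (∏ i, h i ^ α i).coeff 0 = 0 :=
      coeff_eq_zero_of_lt_orderTop
        (addVal_apply (Γ := Γ) (R := k) ▸ addVal_prod_pow_pos h hh hα)
    simp [monomials_apply, this]

/-- The residue of g(h) is the constant term of g. Hence the hypotheses and conclusion of Hensel's
lemma pass through evaluation, although evaluation need not be injective. -/
theorem addVal_mvEval_pos_iff {g : MvPowerSeries (Fin n) k} :
    0 < addVal Γ k (mvEval h hh g) ↔ MvPowerSeries.constantCoeff g = 0 := by
  rw [addVal_pos_iff_of_nonneg (addVal_mvEval_nonneg h hh g), coeff_zero_mvEval]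

theorem range_mvEval_comp_le {m : ℕ} (e : Fin m ↪ Fin n) :
    (mvEval (h ∘ e) fun i => hh (e i)).range ≤ (mvEval h hh).range := by
  rintro _ ⟨g, rfl⟩
  exact ⟨MvPowerSeries.rename e g, mvEval_rename e h hh g⟩

end

/-! ### The ring P of power series values -/

section

variable {k Γ : Type*} [Field k] [AddCommGroup Γ] [LinearOrder Γ] [IsOrderedAddMonoid Γ]

/-- Any two evaluations factor through a common one. -/
theorem exists_range_mvEval_le {S : Set (HahnSeries Γ k)} {n m : ℕ}
    {h : Fin n → HahnSeries Γ k} (hh : ∀ i, 0 < (h i).orderTop) (hS : ∀ i, h i ∈ S)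
    {h' : Fin m → HahnSeries Γ k} (hh' : ∀ i, 0 < (h' i).orderTop) (hS' : ∀ i, h' i ∈ S) :
    ∃ (N : ℕ) (f : Fin N → HahnSeries Γ k) (hf : ∀ i, 0 < (f i).orderTop), (∀ i, f i ∈ S) ∧
      (mvEval h hh).range ≤ (mvEval f hf).range ∧
      (mvEval h' hh').range ≤ (mvEval f hf).range := by
  have hf : ∀ i, 0 < (Fin.append h h' i).orderTop := fun i => by
    refine Fin.addCases (fun i => ?_) (fun i => ?_) i
    · simpa using hh i
    · simpa using hh' i
  refine ⟨n + m, Fin.append h h', hf, fun i => ?_, ?_, ?_⟩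
  · refine Fin.addCases (fun i => ?_) (fun i => ?_) i
    · simpa using hS i
    · simpa using hS' i
  -- The tuple is generalized because the positivity proof inside `mvEval` depends on it.
  · have key : ∀ (u : Fin n → HahnSeries Γ k) (hu : ∀ i, 0 < (u i).orderTop),
        u = Fin.append h h' ∘ Fin.castAddEmb m →
        (mvEval u hu).range ≤ (mvEval (Fin.append h h') hf).range := by
      rintro _ _ rfl
      exact range_mvEval_comp_le _ hf _
    exact key h hh (by ext1 i; simp)
  · have key : ∀ (u : Fin m → HahnSeries Γ k) (hu : ∀ i, 0 < (u i).orderTop),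
        u = Fin.append h h' ∘ Fin.natAddEmb n →
        (mvEval u hu).range ≤ (mvEval (Fin.append h h') hf).range := by
      rintro _ _ rfl
      exact range_mvEval_comp_le _ hf _
    exact key h' hh' (by ext1 i; simp)

/-- The ring of the values of multivariate power series at elements of `S` of positive order. -/
def powerSeriesClosure (S : Set (HahnSeries Γ k)) : Subalgebra k (HahnSeries Γ k) where
  carrier := {z | ∃ (n : ℕ) (h : Fin n → HahnSeries Γ k) (hh : ∀ i, 0 < (h i).orderTop),
    (∀ i, h i ∈ S) ∧ z ∈ (mvEval h hh).range}
  mul_mem' := by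
    rintro x y ⟨n, h, hh, hS, hx⟩ ⟨m, h', hh', hS', hy⟩
    obtain ⟨N, f, hf, hfS, hle, hle'⟩ := exists_range_mvEval_le hh hS hh' hS'
    exact ⟨N, f, hf, hfS, mul_mem (hle hx) (hle' hy)⟩
  add_mem' := by
    rintro x y ⟨n, h, hh, hS, hx⟩ ⟨m, h', hh', hS', hy⟩
    obtain ⟨N, f, hf, hfS, hle, hle'⟩ := exists_range_mvEval_le hh hS hh' hS'
    exact ⟨N, f, hf, hfS, add_mem (hle hx) (hle' hy)⟩
  algebraMap_mem' := fun c =>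
    ⟨0, Fin.elim0, fun i => i.elim0, fun i => i.elim0, Subalgebra.algebraMap_mem _ c⟩

theorem exists_forall_mem_range_mvEval {S : Set (HahnSeries Γ k)} (T : Finset (HahnSeries Γ k))
    (hT : ∀ z ∈ T, z ∈ powerSeriesClosure S) :
    ∃ (n : ℕ) (h : Fin n → HahnSeries Γ k) (hh : ∀ i, 0 < (h i).orderTop),
        (∀ i, h i ∈ S) ∧ ∀ z ∈ T, z ∈ (mvEval h hh).range := by
  classical
  induction T using Finset.induction_on with
  | empty => exact ⟨0, Fin.elim0, fun i => i.elim0, fun i => i.elim0, by simp⟩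
  | insert a T _ ih =>
    obtain ⟨n, h, hh, hS, hx⟩ := ih fun z hz => hT z (Finset.mem_insert_of_mem hz)
    obtain ⟨m, h', hh', hS', hy⟩ := hT a (Finset.mem_insert_self a T)
    obtain ⟨N, f, hf, hfS, hle, hle'⟩ := exists_range_mvEval_le hh hS hh' hS'
    refine ⟨N, f, hf, hfS, fun z hz => ?_⟩
    rcases Finset.mem_insert.1 hz with rfl | hz
    · exact hle' hy
    · exact hle (hx z hz)

theorem addVal_nonneg_of_mem_powerSeriesClosure {S : Set (HahnSeries Γ k)} {z : HahnSeries Γ k}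
    (hz : z ∈ powerSeriesClosure S) : 0 ≤ addVal Γ k z := by
  obtain ⟨n, h, hh, -, g, rfl⟩ := hz
  exact addVal_mvEval_nonneg h hh g

theorem inv_mem_powerSeriesClosure {S : Set (HahnSeries Γ k)} {z : HahnSeries Γ k}
    (hz : z ∈ powerSeriesClosure S) (hz0 : addVal Γ k z = 0) : z⁻¹ ∈ powerSeriesClosure S := by
  obtain ⟨n, h, hh, hS, g, rfl⟩ := hz
  refine ⟨n, h, hh, hS, g⁻¹, ?_⟩
  have hg : MvPowerSeries.constantCoeff g ≠ 0 := fun hg =>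
    ((addVal_mvEval_pos_iff h hh).2 hg).ne' hz0
  refine eq_inv_of_mul_eq_one_right ?_
  change mvEval h hh g * mvEval h hh g⁻¹ = 1
  rw [← map_mul, MvPowerSeries.mul_inv_cancel g hg, map_one]

/-- Subtracting the residue leaves an element of `S` of positive value, at which the series X can be
evaluated. -/
theorem mem_powerSeriesClosure_of_nonneg {S : Subalgebra k (HahnSeries Γ k)}
    {r : HahnSeries Γ k} (hr : r ∈ S) (hr0 : 0 ≤ addVal Γ k r) :
    r ∈ powerSeriesClosure (S : Set (HahnSeries Γ k)) := by
  have hC : ∀ c : k, (C c : HahnSeries Γ k) = algebraMap k _ c := fun c => by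
    simp [HahnSeries.algebraMap_apply]
  have hpos := addVal_sub_C_pos hr0
  have hmem : r - C (r.coeff 0) ∈ powerSeriesClosure (S : Set (HahnSeries Γ k)) := by
    refine ⟨1, fun _ => r - C (r.coeff 0), fun _ => addVal_apply (Γ := Γ) (R := k) ▸ hpos,
      fun _ => sub_mem hr ?_, MvPowerSeries.X 0, mvEval_X _ _ 0⟩
    rw [hC]
    exact S.algebraMap_mem _
  have := add_mem hmem ((powerSeriesClosure (S : Set (HahnSeries Γ k))).algebraMap_mem (r.coeff 0))
  rwa [← hC, sub_add_cancel] at this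

end

end HahnSeries

/-! ### The field E of monomial multiples, with valuation ring P -/

namespace HahnSeries

section

variable {k Γ : Type*} [Field k] [AddCommGroup Γ] [LinearOrder Γ] [IsOrderedAddMonoid Γ]

theorem exists_pos_forall_le_addVal [Nontrivial Γ] {ι : Type*} (s : Finset ι)
    (h : ι → HahnSeries Γ k) (hh : ∀ i ∈ s, 0 < addVal Γ k (h i)) :
    ∃ ε : Γ, 0 < ε ∧ ∀ i ∈ s, (ε : WithTop Γ) ≤ addVal Γ k (h i) := by
  classical
  induction s using Finset.induction_on with
  | empty =>
    obtain ⟨ε, hε⟩ := exists_zero_lt (α := Γ)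
    exact ⟨ε, hε, by simp⟩
  | insert a s _ ih =>
    obtain ⟨ε, hε, hle⟩ := ih fun i hi => hh i (Finset.mem_insert_of_mem hi)
    have ha := hh a (Finset.mem_insert_self a s)
    by_cases htop : addVal Γ k (h a) = ⊤
    · refine ⟨ε, hε, fun i hi => ?_⟩
      rcases Finset.mem_insert.1 hi with rfl | hi
      · simp [htop]
      · exact hle i hi
    · obtain ⟨δ, hδ⟩ := WithTop.ne_top_iff_exists.1 htop
      refine ⟨min ε δ, lt_min hε ?_, fun i hi => ?_⟩
      · rw [← hδ] at ha
        exact_mod_cast ha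
      · rcases Finset.mem_insert.1 hi with rfl | hi
        · rw [← hδ]
          exact_mod_cast min_le_right ε δ
        · exact le_trans (by exact_mod_cast min_le_left ε δ) (hle i hi)

/-- A monomial multiple of a power series value is the sum of an element of `S` and of a power
series value. -/
theorem exists_add_eq_single_mul [Archimedean Γ] [Nontrivial Γ] {S : Subalgebra k (HahnSeries Γ k)}
    (hS : ∀ γ : Γ, single γ (1 : k) ∈ S) {z : HahnSeries Γ k}
    (hz : z ∈ powerSeriesClosure (S : Set (HahnSeries Γ k))) (γ : Γ) :
    ∃ r ∈ S, ∃ a ∈ powerSeriesClosure (S : Set (HahnSeries Γ k)), single γ 1 * z = r + a := by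
  obtain ⟨n, h, hh, hhS, g, rfl⟩ := hz
  change ∃ r ∈ S, ∃ a ∈ powerSeriesClosure (S : Set (HahnSeries Γ k)),
    single γ 1 * mvEval h hh g = r + a
  obtain ⟨ε, hε, hle⟩ := exists_pos_forall_le_addVal Finset.univ h
    fun i _ => addVal_apply (x := h i) ▸ hh i
  -- N bounds the number of shifts by ε that make the exponent γ nonnegative.
  obtain ⟨N, hN⟩ := Archimedean.arch (-γ) hε
  have hmon : ∀ γ : Γ, 0 ≤ γ → single γ (1 : k) ∈ powerSeriesClosure (S : Set (HahnSeries Γ k)) :=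
    fun γ hγ => mem_powerSeriesClosure_of_nonneg (hS γ) (by
      rw [addVal_single_one]
      exact_mod_cast hγ)
  have hmul : ∀ i, single (-ε) 1 * h i ∈ S := fun i => mul_mem (hS _) (hhS i)
  have hmul' : ∀ i, single (-ε) 1 * h i ∈ powerSeriesClosure (S : Set (HahnSeries Γ k)) :=
    fun i => mem_powerSeriesClosure_of_nonneg (hmul i) (by
      have h1 : ((-ε : Γ) : WithTop Γ) + (ε : WithTop Γ) ≤ (-ε : Γ) + addVal Γ k (h i) := by
        gcongr
        exact hle i (Finset.mem_univ i)
      rw [AddValuation.map_mul, addVal_single_one]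
      refine le_trans ?_ h1
      rw [← WithTop.coe_add, neg_add_cancel, WithTop.coe_zero])
  induction N generalizing γ g with
  | zero =>
    refine ⟨0, zero_mem _, single γ 1 * mvEval h hh g,
      mul_mem (hmon γ (by simpa using hN)) ⟨n, h, hh, hhS, g, rfl⟩, by simp⟩
  | succ N ih =>
    -- Then t^γ g(h) = c t^γ + ∑ (t^(γ+ε) uᵢ(h)) (t^(-ε) hᵢ), where t^(-ε) hᵢ lies in both `S` and
    -- P, and induction applies to the first factors.
    obtain ⟨c, u, hu⟩ : ∃ (c : k) (u : Fin n → MvPowerSeries (Fin n) k),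
        g = MvPowerSeries.C c + ∑ i, u i * MvPowerSeries.X i := by
      have hmem : g - MvPowerSeries.C (MvPowerSeries.constantCoeff g) ∈
          Ideal.span (Set.range (MvPowerSeries.X : Fin n → MvPowerSeries (Fin n) k)) := by
        rw [MvPowerSeries.mem_span_range_X_iff]
        simp
      obtain ⟨u, hu⟩ := Ideal.mem_span_range_iff_exists_fun.1 hmem
      exact ⟨_, u, by rw [hu]; ring⟩
    have hstep : ∀ i, ∃ r ∈ S, ∃ a ∈ powerSeriesClosure (S : Set (HahnSeries Γ k)),
        single (γ + ε) 1 * mvEval h hh (u i) = r + a := fun i =>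
      ih (γ + ε) (u i) (by
        rw [succ_nsmul] at hN
        rw [neg_add, ← sub_eq_add_neg]
        exact sub_le_iff_le_add.2 hN)
    choose r hr a ha hra using hstep
    refine ⟨c • single γ 1 + ∑ i, r i * (single (-ε) 1 * h i),
      add_mem (S.smul_mem (hS γ) c) (sum_mem fun i _ => mul_mem (hr i) (hmul i)),
      ∑ i, a i * (single (-ε) 1 * h i), sum_mem fun i _ => mul_mem (ha i) (hmul' i), ?_⟩
    rw [hu, map_add, map_sum, mvEval_C, mul_add, add_assoc, ← Finset.sum_add_distrib,
      Finset.mul_sum]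
    congr 1
    · ext δ
      rw [C_apply, single_mul_single, add_zero, one_mul, HahnSeries.coeff_smul]
      by_cases hδ : δ = γ
      · simp [hδ]
      · simp [coeff_single_of_ne hδ]
    · refine Finset.sum_congr rfl fun i _ => ?_
      rw [map_mul, mvEval_X, ← add_mul, ← hra]
      have : single γ (1 : k) = single (γ + ε) 1 * single (-ε) 1 := by simp
      rw [this]
      ring

/-- In the splitting r + a, the value of r is nonnegative because those of the sum and of a are, so
r too lies in P. -/
theorem single_mul_mem_powerSeriesClosure [Archimedean Γ] [Nontrivial Γ]
    {S : Subalgebra k (HahnSeries Γ k)} (hS : ∀ γ : Γ, single γ (1 : k) ∈ S) {z : HahnSeries Γ k}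
    (hz : z ∈ powerSeriesClosure (S : Set (HahnSeries Γ k))) {γ : Γ}
    (hγ : 0 ≤ addVal Γ k (single γ 1 * z)) :
    single γ 1 * z ∈ powerSeriesClosure (S : Set (HahnSeries Γ k)) := by
  obtain ⟨r, hr, a, ha, h⟩ := exists_add_eq_single_mul hS hz γ
  rw [h] at hγ ⊢
  refine add_mem (mem_powerSeriesClosure_of_nonneg hr ?_) ha
  rw [← add_sub_cancel_right r a]
  exact (addVal Γ k).map_le_sub hγ (addVal_nonneg_of_mem_powerSeriesClosure ha)

theorem single_mul_mem_powerSeriesClosure_of_le {S : Subalgebra k (HahnSeries Γ k)}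
    (hS : ∀ γ : Γ, single γ (1 : k) ∈ S) {y : HahnSeries Γ k} {γ δ : Γ} (hle : γ ≤ δ)
    (hy : single γ 1 * y ∈ powerSeriesClosure (S : Set (HahnSeries Γ k))) :
    single δ 1 * y ∈ powerSeriesClosure (S : Set (HahnSeries Γ k)) := by
  rw [← sub_add_cancel δ γ, ← single_one_mul_single_one_mul]
  refine mul_mem (mem_powerSeriesClosure_of_nonneg (hS _) ?_) hy
  rw [addVal_single_one]
  exact_mod_cast sub_nonneg.2 hle

theorem exists_addVal_eq_coe {y : HahnSeries Γ k} (hy : y ≠ 0) :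
    ∃ β : Γ, addVal Γ k y = β :=
  ⟨_, addVal_apply_of_ne hy⟩

/-- The field of the monomial multiples of the values of power series at elements of `S` of positive
order. -/
def monomialMulPowerSeriesClosure [Archimedean Γ] [Nontrivial Γ] (S : Subalgebra k (HahnSeries Γ k))
    (hS : ∀ γ : Γ, single γ (1 : k) ∈ S) : IntermediateField k (HahnSeries Γ k) where
  carrier := {y | ∃ γ : Γ, single γ 1 * y ∈ powerSeriesClosure (S : Set (HahnSeries Γ k))}
  mul_mem' := by
    rintro x y ⟨γ, hx⟩ ⟨δ, hy⟩
    refine ⟨γ + δ, ?_⟩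
    have : single (γ + δ) (1 : k) * (x * y) = (single γ 1 * x) * (single δ 1 * y) := by
      rw [← single_one_mul_single_one_mul]
      ring
    rw [this]
    exact mul_mem hx hy
  add_mem' := by
    rintro x y ⟨γ, hx⟩ ⟨δ, hy⟩
    refine ⟨max γ δ, ?_⟩
    rw [mul_add]
    exact add_mem (single_mul_mem_powerSeriesClosure_of_le hS (le_max_left γ δ) hx)
      (single_mul_mem_powerSeriesClosure_of_le hS (le_max_right γ δ) hy)
  algebraMap_mem' := fun c => ⟨0, by
    rw [single_zero_one, one_mul]
    exact Subalgebra.algebraMap_mem _ c⟩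
  inv_mem' := by
    rintro y ⟨γ, hy⟩
    by_cases hy0 : y = 0
    · exact ⟨0, by simp [hy0]⟩
    obtain ⟨β, hβ⟩ := exists_addVal_eq_coe hy0
    -- Normalized to value 0, y becomes a unit of P, whose inverse is t^β y⁻¹.
    have h0 : addVal Γ k (single (-β) 1 * y) = 0 := by
      rw [AddValuation.map_mul, addVal_single_one, hβ, ← WithTop.coe_add, neg_add_cancel,
        WithTop.coe_zero]
    have heq : single (-β) (1 : k) * y = single (-β - γ) 1 * (single γ 1 * y) := by
      rw [single_one_mul_single_one_mul, sub_add_cancel]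
    refine ⟨β, ?_⟩
    have hmem : single (-β) (1 : k) * y ∈ powerSeriesClosure (S : Set (HahnSeries Γ k)) := by
      rw [heq] at h0 ⊢
      exact single_mul_mem_powerSeriesClosure hS hy h0.ge
    have hinv := inv_mem_powerSeriesClosure hmem h0
    rwa [mul_inv, inv_single, neg_neg, inv_one] at hinv

variable [Archimedean Γ] [Nontrivial Γ] {S : Subalgebra k (HahnSeries Γ k)}
  (hS : ∀ γ : Γ, single γ (1 : k) ∈ S)

theorem mem_powerSeriesClosure_iff {y : HahnSeries Γ k} :
    y ∈ powerSeriesClosure (S : Set (HahnSeries Γ k)) ↔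
      y ∈ monomialMulPowerSeriesClosure S hS ∧ 0 ≤ addVal Γ k y := by
  constructor
  · exact fun hy => ⟨⟨0, by rwa [single_zero_one, one_mul]⟩,
      addVal_nonneg_of_mem_powerSeriesClosure hy⟩
  · rintro ⟨⟨γ, hy⟩, hy0⟩
    rw [← single_neg_one_mul_cancel γ y] at hy0 ⊢
    exact single_mul_mem_powerSeriesClosure hS hy hy0

theorem le_monomialMulPowerSeriesClosure {y : HahnSeries Γ k} (hy : y ∈ S) :
    y ∈ monomialMulPowerSeriesClosure S hS := by
  by_cases hy0 : y = 0
  · exact hy0 ▸ zero_mem _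
  obtain ⟨β, hβ⟩ := exists_addVal_eq_coe hy0
  refine ⟨-β, mem_powerSeriesClosure_of_nonneg (mul_mem (hS _) hy) (le_of_eq ?_)⟩
  rw [AddValuation.map_mul, addVal_single_one, hβ, ← WithTop.coe_add, neg_add_cancel,
    WithTop.coe_zero]

end

/-! ### Henselianity of E -/

section

variable {k Γ : Type*} [Field k] [AddCommGroup Γ] [LinearOrder Γ] [IsOrderedAddMonoid Γ]

theorem mem_integer_restrictedVal {E : IntermediateField k (HahnSeries Γ k)} {x : E} :
    x ∈ (restrictedVal E).toValuation.integer ↔ 0 ≤ addVal Γ k (x : HahnSeries Γ k) :=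
  Iff.rfl

theorem isUnit_integer_restrictedVal_iff {E : IntermediateField k (HahnSeries Γ k)}
    {x : (restrictedVal E).toValuation.integer} :
    IsUnit x ↔ addVal Γ k ((x : E) : HahnSeries Γ k) = 0 := by
  constructor
  · intro hx
    obtain ⟨y, hy⟩ := hx.exists_right_inv
    have h1 : addVal Γ k ((x : E) : HahnSeries Γ k) + addVal Γ k ((y : E) : HahnSeries Γ k) = 0 := by
      rw [← AddValuation.map_mul]
      have : ((x : E) : HahnSeries Γ k) * ((y : E) : HahnSeries Γ k) = 1 :=
        congrArg (fun z : (restrictedVal E).toValuation.integer => ((z : E) : HahnSeries Γ k)) hy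
      rw [this, AddValuation.map_one]
    refine le_antisymm ?_ (mem_integer_restrictedVal.1 x.2)
    rw [← h1]
    exact le_add_of_nonneg_right (mem_integer_restrictedVal.1 y.2)
  · intro hx
    have hx0 : (x : E) ≠ 0 := by
      intro h0
      rw [h0] at hx
      simp at hx
    have hinv : addVal Γ k (((x : E)⁻¹ : E) : HahnSeries Γ k) = 0 := by
      have h1 : addVal Γ k ((x : E) : HahnSeries Γ k) +
          addVal Γ k (((x : E)⁻¹ : E) : HahnSeries Γ k) = 0 := by
        rw [← AddValuation.map_mul]
        have : ((x : E) : HahnSeries Γ k) * (((x : E)⁻¹ : E) : HahnSeries Γ k) = 1 := by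
          exact_mod_cast congrArg (fun z : E => (z : HahnSeries Γ k)) (mul_inv_cancel₀ hx0)
        rw [this, AddValuation.map_one]
      rwa [hx, zero_add] at h1
    exact IsUnit.of_mul_eq_one ⟨(x : E)⁻¹, mem_integer_restrictedVal.2 hinv.ge⟩
      (Subtype.ext (mul_inv_cancel₀ hx0))

instance isLocalRing_integer_restrictedVal (E : IntermediateField k (HahnSeries Γ k)) :
    IsLocalRing (restrictedVal E).toValuation.integer := by
  refine IsLocalRing.of_nonunits_add fun a b ha hb => ?_
  rw [mem_nonunits_iff, isUnit_integer_restrictedVal_iff] at ha hb ⊢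
  have ha' := lt_of_le_of_ne (mem_integer_restrictedVal.1 a.2) (Ne.symm ha)
  have hb' := lt_of_le_of_ne (mem_integer_restrictedVal.1 b.2) (Ne.symm hb)
  exact ((addVal Γ k).map_lt_add ha' hb').ne'

theorem mem_maximalIdeal_integer_restrictedVal {E : IntermediateField k (HahnSeries Γ k)}
    {x : (restrictedVal E).toValuation.integer} :
    x ∈ IsLocalRing.maximalIdeal (restrictedVal E).toValuation.integer ↔
      0 < addVal Γ k ((x : E) : HahnSeries Γ k) := by
  rw [IsLocalRing.mem_maximalIdeal, mem_nonunits_iff, isUnit_integer_restrictedVal_iff]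
  exact ⟨fun h => lt_of_le_of_ne (mem_integer_restrictedVal.1 x.2) (Ne.symm h), fun h => h.ne'⟩

/-- Hensel's lemma for multivariate power series over a field. -/
theorem exists_isRoot_mvPowerSeries {n : ℕ} (F : Polynomial (MvPowerSeries (Fin n) k))
    (hF : F.Monic) (b : MvPowerSeries (Fin n) k) (hb : MvPowerSeries.constantCoeff (F.eval b) = 0)
    (hb' : MvPowerSeries.constantCoeff (F.derivative.eval b) ≠ 0) :
    ∃ a, F.IsRoot a ∧ MvPowerSeries.constantCoeff (a - b) = 0 := by
  obtain ⟨a, ha, hab⟩ := HenselianRing.is_henselian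
    (I := Ideal.span (Set.range (MvPowerSeries.X : Fin n → MvPowerSeries (Fin n) k))) F hF b
    (MvPowerSeries.mem_span_range_X_iff.2 hb)
    ((MvPowerSeries.isUnit_iff_constantCoeff.2 (isUnit_iff_ne_zero.2 hb')).map _)
  exact ⟨a, ha, MvPowerSeries.mem_span_range_X_iff.1 hab⟩

variable [Archimedean Γ] [Nontrivial Γ] {S : Subalgebra k (HahnSeries Γ k)}
  (hS : ∀ γ : Γ, single γ (1 : k) ∈ S)

theorem isHenselianSubfield_monomialMulPowerSeriesClosure :
    IsHenselianSubfield (monomialMulPowerSeriesClosure S hS) := by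
  classical
  set E := monomialMulPowerSeriesClosure S hS with hE
  refine { is_henselian := fun f hf a₀ h₁ h₂ => ?_ }
  let ι : (restrictedVal E).toValuation.integer →+* HahnSeries Γ k :=
    (algebraMap E (HahnSeries Γ k)).comp (restrictedVal E).toValuation.integer.subtype
  have hιinj : Function.Injective ι := fun x y hxy => Subtype.ext (Subtype.ext hxy)
  have hι : ∀ x, ι x ∈ powerSeriesClosure (S : Set (HahnSeries Γ k)) := fun x =>
    (mem_powerSeriesClosure_iff hS).2 ⟨(x : E).2, mem_integer_restrictedVal.1 x.2⟩
  -- One tuple h serves for the approximate root and all coefficients of f at once.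
  obtain ⟨n, h, hh, hhS, hmem⟩ := exists_forall_mem_range_mvEval
    (S := (S : Set (HahnSeries Γ k)))
    (insert (ι a₀) ((Finset.range (f.natDegree + 1)).image fun i => ι (f.coeff i))) (by
      intro z hz
      rcases Finset.mem_insert.1 hz with rfl | hz
      · exact hι _
      · obtain ⟨i, -, rfl⟩ := Finset.mem_image.1 hz
        exact hι _)
  obtain ⟨b₀, hb₀⟩ := hmem _ (Finset.mem_insert_self _ _)
  have hlift : f.map ι ∈ Polynomial.lifts (mvEval h hh).toRingHom := by
    rw [Polynomial.lifts_iff_coeff_lifts]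
    intro i
    rw [Polynomial.coeff_map]
    by_cases hi : i < f.natDegree + 1
    · exact hmem _ (Finset.mem_insert_of_mem
        (Finset.mem_image_of_mem _ (Finset.mem_range.2 hi)))
    · rw [Polynomial.coeff_eq_zero_of_natDegree_lt (by omega), map_zero]
      exact ⟨0, map_zero _⟩
  obtain ⟨F, hFmap, -, hF⟩ := Polynomial.lifts_and_natDegree_eq_and_monic hlift (hf.map ι)
  have heval : ∀ (P : Polynomial (MvPowerSeries (Fin n) k))
      (Q : Polynomial (restrictedVal E).toValuation.integer)
      (b : MvPowerSeries (Fin n) k) (a : (restrictedVal E).toValuation.integer),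
      P.map (mvEval h hh).toRingHom = Q.map ι → mvEval h hh b = ι a →
      mvEval h hh (P.eval b) = ι (Q.eval a) := by
    intro P Q b a hPQ hba
    have h1 := Polynomial.eval_map_apply (f := (mvEval h hh).toRingHom)
      (p := P) b
    have h2 := Polynomial.eval_map_apply (f := ι) (p := Q) a
    rw [← h2, ← hPQ, ← hba]
    exact h1.symm
  have hb₀' : mvEval h hh b₀ = ι a₀ := hb₀
  have e1 := heval F f b₀ a₀ hFmap hb₀'
  have e2 := heval F.derivative f.derivative b₀ a₀
    (by rw [← Polynomial.derivative_map, hFmap, Polynomial.derivative_map]) hb₀'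
  obtain ⟨b, hb, hbb⟩ := exists_isRoot_mvPowerSeries F hF b₀
    ((addVal_mvEval_pos_iff h hh).1 (by
      rw [e1]
      exact mem_maximalIdeal_integer_restrictedVal.1 h₁))
    (fun h0 => by
      have := (addVal_mvEval_pos_iff h hh).2 h0
      rw [e2] at this
      exact this.ne' (isUnit_integer_restrictedVal_iff.1 h₂))
  obtain ⟨hbE, hb0⟩ := (mem_powerSeriesClosure_iff hS).1
    (show mvEval h hh b ∈ powerSeriesClosure (S : Set (HahnSeries Γ k)) from
      ⟨n, h, hh, hhS, b, rfl⟩)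
  let a : (restrictedVal E).toValuation.integer := ⟨⟨mvEval h hh b, hbE⟩, hb0⟩
  refine ⟨a, ?_, mem_maximalIdeal_integer_restrictedVal.2 ?_⟩
  · refine hιinj ?_
    rw [← heval F f b a hFmap rfl, hb.eq_zero, map_zero, map_zero]
  · have := (addVal_mvEval_pos_iff h hh).2 hbb
    rw [map_sub, hb₀'] at this
    exact this

end

/-- The elements of the henselization of `k(t^Γ, w)` are `w`-quasi-finite, for every archimedean
value group and every generalized power series `w`. -/
theorem isQuasiFinite_of_mem_henselizationIn {k Γ : Type*} [Field k] [AddCommGroup Γ]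
    [LinearOrder Γ] [IsOrderedAddMonoid Γ] [Archimedean Γ] [Nontrivial Γ] {w y : HahnSeries Γ k}
    (hy : y ∈ henselizationIn (monomialFieldAdjoin w)) : IsQuasiFinite w y := by
  let S : Subalgebra k (HahnSeries Γ k) :=
    (Algebra.adjoin (monomialField k Γ) ({w} : Set (HahnSeries Γ k))).restrictScalars k
  have hS : ∀ γ : Γ, single γ (1 : k) ∈ S := fun γ =>
    (Algebra.adjoin (monomialField k Γ) ({w} : Set (HahnSeries Γ k))).algebraMap_mem
      ⟨tPow k Γ γ, IntermediateField.subset_adjoin _ _ ⟨γ, rfl⟩⟩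
  have hw : w ∈ S := Algebra.subset_adjoin (R := monomialField k Γ) (Set.mem_singleton w)
  have hle : monomialFieldAdjoin w ≤ monomialMulPowerSeriesClosure S hS := by
    refine IntermediateField.adjoin_le_iff.2 ?_
    rintro x (⟨γ, rfl⟩ | hxw)
    · exact le_monomialMulPowerSeriesClosure hS (hS γ)
    · rw [Set.mem_singleton_iff] at hxw
      exact hxw ▸ le_monomialMulPowerSeriesClosure hS hw
  have hyE : y ∈ monomialMulPowerSeriesClosure S hS :=
    IntermediateField.mem_sInf.1 hy _
      ⟨hle, isHenselianSubfield_monomialMulPowerSeriesClosure hS⟩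
  obtain ⟨γ, hγ⟩ := hyE
  -- Raising γ to max γ 0 stays in P and makes the final exponent -max γ 0 at most 0.
  obtain ⟨n, h, hh, hhS, g, hg⟩ :=
    single_mul_mem_powerSeriesClosure_of_le hS (le_max_left γ 0) hγ
  refine ⟨-max γ 0, n, h, g, mvEval h hh g, by simp, hhS, fun i => ?_,
    isPowerSeriesValue_mvEval h hh g, ?_⟩
  · rw [addVal_apply]
    exact hh i
  · have hg' : mvEval h hh g = single (max γ 0) 1 * y := hg
    rw [hg', tPow, single_neg_one_mul_cancel]

end HahnSeries

theorem mainTheorem7 (p q : ℕ) (hp : p.Prime) (hq : q.Prime) (hpq : p ≠ q)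
    (k : Type*) [Field k] [CharP k p]
    (Γ : AddSubgroup ℚ) (hΓ : ∀ i : ℕ, 1 / (q : ℚ) ^ i ∈ Γ)
    (y : HahnSeries Γ k)
    (hy : y ∈ henselizationIn (monomialFieldAdjoin (wSeries k Γ q))) :
    IsQuasiFinite (wSeries k Γ q) y := by
  -- Γ contains 1 = 1/q^0.
  have hne : Nontrivial Γ :=
    ⟨⟨0, ⟨1, by simpa using hΓ 0⟩, fun h => zero_ne_one (congrArg Subtype.val h)⟩⟩
  have harch : Archimedean Γ := ⟨fun x y hy => by
    obtain ⟨n, hn⟩ := Archimedean.arch (x : ℚ) (show (0 : ℚ) < y from hy)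
    exact ⟨n, by exact_mod_cast hn⟩⟩
  exact HahnSeries.isQuasiFinite_of_mem_henselizationIn hy
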